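/- Let $\Sigma$ be a finite alphabet, $m$ a prime number and $z=z_1z_2\cdots z_n\in\Sigma^*$ a string of length $n\ge 1$. Let $$L_z(m)=\Sigma^*z_1\Sigma^*z_2\Sigma^*\cdots\Sigma^*z_n\Sigma^*\ \cap\ \{w\in\Sigma^* : |w|=km \text{ for some } k=1,2,3,\dots\}.$$ *Multi-letter 1QFA.* For $k\ge1$, a $k$-letter one-way quantum finite automaton consists of a finite set $Q$ of basis states, a unit vector $|\psi_0\rangle\in\mathbb C^Q$, a unitary operator $U_w$ on $\mathbb C^Q$ for every $w\in(\{\Lambda\}\cup\Sigma)^k$, where $\Lambda\notin\Sigma$ is a padding symbol, and a set $Q_{acc}\subseteq Q$. On input $x=\sigma_1\cdots\sigma_l$ it applies to $|\psi_0\rangle$, for $i=1,\dots,l$ in this order, the operator $U_w$ where $w$ consists of the last $k$ letters of $\Lambda^k\sigma_1\cdots\sigma_i$; it accepts $x$ with probability $\sum_{q\in Q_{acc}}|\langle q|\psi_x\rangle|^2$, where $|\psi_x\rangle$ is the final state. It accepts a language $L$ (with bounded error) if there are $\lambda\in(0,1]$ and $\delta>0$ such that every $x\in L$ is accepted with probability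 at least $\lambda+\delta$ and every $x\notin L$ with probability at most $\lambda-\delta$. A multi-letter 1QFA is a $k$-letter 1QFA for some $k\ge 1$. *1QFAC.* A one-way quantum finite automaton together with classical states (1QFAC), used as an acceptor, consists of a finite set $S$ of classical states with an initial state $s_0\in S$, a finite set $Q$ of quantum basis states, a unit vector $|\psi_0\rangle\in\mathbb C^Q$, a map $\delta:S\times\Sigma\to S$, a unitary operator $U_{s\sigma}$ on $\mathbb C^Q$ for all $s\in S$, $\sigma\in\Sigma$, and for every $s\in S$ orthogonal projections $P_{s,a},P_{s,r}$ on $\mathbb C^Q$ with $P_{s,a}+P_{s,r}=I$ and $P_{s,a}P_{s,r}=P_{s,r}P_{s,a}=0$. It starts in $(s_0,|\psi_0\rangle)$; on reading $\sigma$ in $(s,|\psi\rangle)$ it moves to $(\delta(s,\sigma),U_{s\sigma}|\psi\rangle)$; if it is in $(s,|\psi\rangle)$ after reading the input $x$, then it accepts $x$ with probability $\|P_{s,a}|\psi\rangle\|^2$. **Theorem.** The language $L_z(m)$ is regular, and: 1. if $\Sigma$ has at least two letters, then no multi-letter 1QFA accepts $L_z(m)$ with bounded error; 2. for every $\varepsilon>0$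 there is a 1QFAC with $n+1$ classical states (independently of $m$) and $O(\log m)$ quantum basis states that accepts every $x\in L_z(m)$ with probability $1$ and every $x\notin L_z(m)$ with probability smaller than $\varepsilon$. That is, the number of quantum basis states is at most $C_\varepsilon\log m$, with a constant $C_\varepsilon$ that depends only on $\varepsilon$; 3. if $\Sigma$ has at least two letters, then the minimal DFA accepting $L_z(m)$ has $m(n+1)$ states. -/

import Mathlib

universe u

/-! ## Languages -/

/-- The language `Σ* z₁ Σ* z₂ Σ* ⋯ Σ* zₙ Σ*` of a string `z = z₁z₂⋯zₙ` (here `⊤ = Σ*`, and `*` is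
concatenation of languages). -/
def scatteredLanguage {α : Type*} : List α → Language α
  | [] => ⊤
  | a :: z => ⊤ * {[a]} * scatteredLanguage z

/-- The language `L(m) = {w : |w| = k m for some k = 1, 2, 3, …}`. -/
def lengthLanguage (α : Type*) (m : ℕ) : Language α :=
  {w : List α | ∃ k : ℕ, 1 ≤ k ∧ w.length = k * m}

/-- The language `L_z(m) = L_z ∩ L(m)`. -/
def scatteredLengthLanguage {α : Type*} (z : List α) (m : ℕ) : Language α :=
  scatteredLanguage z ⊓ lengthLanguage α m

/-- `N` is the number of states of a minimal (complete) DFA accepting `L`: some DFA with `N` states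
accepts `L`, and every finite DFA accepting `L` has at least `N` states. -/
def IsMinimalDFASize {α : Type*} (L : Language α) (N : ℕ) : Prop :=
  IsLeast {k : ℕ | ∃ (σ : Type) (_ : Fintype σ) (M : DFA α σ),
    Fintype.card σ = k ∧ M.accepts = L} N

/-! ## Multi-letter one-way quantum finite automata

`EuclideanSpace ℂ Q` is the Hilbert space with orthonormal basis indexed by `Q`, and its unitary
operators are its linear isometric self-equivalences. -/

/-- A `k`-letter 1QFA over the input alphabet `α` with quantum basis states `Q`. A word of length `k`
over `{Λ} ∪ α` is a function `Fin k → Option α`, where the padding symbol `Λ` is `none`. -/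
structure MultiLetterQFA (k : ℕ) (α Q : Type*) [Fintype Q] where
  /-- the initial superposition -/
  init : EuclideanSpace ℂ Q
  norm_init : ‖init‖ = 1
  /-- the unitary operator of each word of length `k` over `{Λ} ∪ α` -/
  U : (Fin k → Option α) → (EuclideanSpace ℂ Q ≃ₗᵢ[ℂ] EuclideanSpace ℂ Q)
  /-- the accepting basis states -/
  acc : Finset Q

namespace MultiLetterQFA

variable {k : ℕ} {α Q : Type*} [Fintype Q]

/-- Append the letter `a` on the right of the window of the last `k` letters, and drop the oldest
letter of the window. -/
def shift (w : Fin k → Option α) (a : α) : Fin k → Option α :=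
  fun j => if h : (j : ℕ) + 1 < k then w ⟨j + 1, h⟩ else some a

/-- The window of the last `k` letters (padded with `Λ` on the left) and the quantum state after
reading `x`. On reading a letter, the operator of the window that ends in this letter is applied. -/
noncomputable def run (A : MultiLetterQFA k α Q) (x : List α) : (Fin k → Option α) × EuclideanSpace ℂ Q :=
  x.foldl (fun c a => (shift c.1 a, A.U (shift c.1 a) c.2)) (fun _ => none, A.init)

/-- The accepting probability `‖P_acc ψ_x‖²`, with `P_acc` the projection onto the span of the
accepting basis states. -/
noncomputable def acceptProb (A : MultiLetterQFA k α Q) (x : List α) : ℝ :=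
  ∑ q ∈ A.acc, ‖(A.run x).2 q‖ ^ 2

/-- `A` accepts `L` with bounded error: the accepting probabilities of the words in `L` and of the
words outside `L` are separated by a cut-point that is isolated. -/
def AcceptsBoundedError (A : MultiLetterQFA k α Q) (L : Language α) : Prop :=
  ∃ c δ : ℝ, 0 < c ∧ c ≤ 1 ∧ 0 < δ ∧
    (∀ x ∈ L, c + δ ≤ A.acceptProb x) ∧ (∀ x ∉ L, A.acceptProb x ≤ c - δ)

end MultiLetterQFA

/-- `L` is accepted with bounded error by some multi-letter 1QFA, that is, by a `k`-letter 1QFA with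
finitely many quantum basis states, for some `k ≥ 1`. -/
def AcceptedByMultiLetterQFA {α : Type*} (L : Language α) : Prop :=
  ∃ (k : ℕ) (Q : Type) (_ : Fintype Q) (A : MultiLetterQFA k α Q),
    1 ≤ k ∧ A.AcceptsBoundedError L

/-! ## One-way quantum finite automata together with classical states -/

/-- A 1QFAC with input alphabet `α`, output alphabet `Γ`, classical states `S` and quantum basis
states `Q`. -/
structure OneQFAC (α Γ S Q : Type*) [Fintype Γ] [Fintype Q] where
  /-- the initial classical state -/
  start : S
  /-- the initial quantum state -/
  init : EuclideanSpace ℂ Q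
  norm_init : ‖init‖ = 1
  /-- the classical transition map -/
  step : S → α → S
  /-- the quantum transition operators -/
  U : S → α → (EuclideanSpace ℂ Q ≃ₗᵢ[ℂ] EuclideanSpace ℂ Q)
  /-- the projective measurement at each classical state -/
  P : S → Γ → (EuclideanSpace ℂ Q →L[ℂ] EuclideanSpace ℂ Q)
  isStarProjection_P : ∀ s γ, IsStarProjection (P s γ)
  orthogonal_P : ∀ s γ γ', γ ≠ γ' → P s γ * P s γ' = 0
  sum_P : ∀ s, ∑ γ, P s γ = 1

namespace OneQFAC

variable {α Γ S Q : Type*} [Fintype Γ] [Fintype Q]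

/-- The classical state and the quantum state after reading `x`. The operator applied on reading a
letter is that of the classical state before this letter. -/
noncomputable def run (A : OneQFAC α Γ S Q) (x : List α) : S × EuclideanSpace ℂ Q :=
  x.foldl (fun c a => (A.step c.1 a, A.U c.1 a c.2)) (A.start, A.init)

/-- The probability that `A` produces the outcome `γ` on the input `x`. -/
noncomputable def prob (A : OneQFAC α Γ S Q) (γ : Γ) (x : List α) : ℝ :=
  ‖A.P (A.run x).1 γ (A.run x).2‖ ^ 2

/-- The accepting probability of a 1QFAC that is used as an acceptor: there are two outcomes, `true`
for accepting and `false` for rejecting. -/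
noncomputable def acceptProb (A : OneQFAC α Bool S Q) (x : List α) : ℝ :=
  A.prob true x

/-- `A` accepts `L` with one-sided error `ε`: words of `L` are accepted with no error, and every
other word is accepted with probability smaller than `ε`. -/
def AcceptsOneSided (A : OneQFAC α Bool S Q) (L : Language α) (ε : ℝ) : Prop :=
  (∀ x ∈ L, A.acceptProb x = 1) ∧ (∀ x ∉ L, A.acceptProb x < ε)

end OneQFAC

/-!
A word lies in `L_z(m)` iff it has `z` as a sublist and its length is divisible by `m`. The greedy
search for `z` (`greedyStep`, `foldl_greedyStep_eq_last`) decides the first condition with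
`z.length + 1` states, so together with a counter modulo `m` it yields a DFA with
`m * (z.length + 1)` states. If there are two letters, the word `z₁ ⋯ zᵢ c ⋯ c` with `c ≠ zᵢ₊₁`
leaves exactly `zᵢ₊₁ ⋯ zₙ` to be found, and the left quotients for the different `i` and the
different lengths modulo `m` are all distinct (`le_card_of_accepts_scatteredLengthLanguage`).

*Multi-letter automata.* Let `b ≠ z₁` and let `B` be a power of `b`, of length divisible by `m` and
at least the window size `k`. After `B` the window contains only copies of `b`, and it does so again
after `B (v B)^j`. Hence each further `v B` applies the same unitary operator `V`, and since the
orbits of `V` are recurrent, some `B (v B)^j` with `j ≥ 1` leads to a state arbitrarily close to the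
state after `B` (`MultiLetterQFA.exists_acceptProb_sub_lt`). With `v = z^m`, the first word is in
the language and the second is not.

*The 1QFAC.* The classical states run the greedy search. The quantum part is the fingerprint of the
length `l` in `ZMod m`: from the uniform superposition of `d` basis states, it reaches the state with
coordinates `χ(κᵢ l) / √d`, where `χ` is the standard additive character. The probability of finding
the initial state is then `|∑ᵢ χ(κᵢ l)|² / d²`. It is `1` for `l = 0`. For `d` of order `log m` some
`κ` makes it small for all `l ≠ 0` at once: bounding the exponential moments of the sums over a
uniformly random `κ` shows that the union bound over all `l` succeeds (`exists_forall_abs_sum_lt`).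
-/

/-! ### Words that contain `z` as a scattered subword -/

theorem mem_scatteredLanguage {α : Type*} {z w : List α} :
    w ∈ scatteredLanguage z ↔ z.Sublist w := by
  induction z generalizing w with
  | nil => exact iff_of_true (Set.mem_univ w) (List.nil_sublist w)
  | cons a z ih =>
    rw [scatteredLanguage, Language.mem_mul, List.cons_sublist_iff]
    constructor
    · rintro ⟨r, hr, s, hs, rfl⟩
      obtain ⟨p, -, q, hq, rfl⟩ := Language.mem_mul.1 hr
      obtain rfl : q = [a] := hq
      exact ⟨_, s, rfl, by simp, ih.1 hs⟩
    · rintro ⟨r, s, rfl, ha, hs⟩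
      obtain ⟨p, q, rfl⟩ := List.append_of_mem ha
      refine ⟨p ++ [a], Language.mem_mul.2 ⟨p, Set.mem_univ p, [a], rfl, rfl⟩, q ++ s,
        ih.2 (hs.trans (List.sublist_append_right q s)), by simp⟩

/-- As `z` is nonempty, the lower bound `1 ≤ k` on the multiple `k * m` is automatic. -/
theorem mem_scatteredLengthLanguage {α : Type*} {z w : List α} {m : ℕ} (hz : 1 ≤ z.length) :
    w ∈ scatteredLengthLanguage z m ↔ z.Sublist w ∧ m ∣ w.length := by
  rw [scatteredLengthLanguage]
  change w ∈ scatteredLanguage z ∧ w ∈ lengthLanguage α m ↔ _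
  rw [mem_scatteredLanguage]
  refine and_congr_right fun h => ⟨?_, ?_⟩
  · rintro ⟨k, -, hk⟩
    exact ⟨k, by rw [hk, mul_comm]⟩
  · rintro ⟨k, hk⟩
    have := h.length_le
    refine ⟨k, Nat.pos_of_ne_zero ?_, by rw [hk, mul_comm]⟩
    rintro rfl
    simp at hk
    simp [hk] at this
    simp [this] at hz

open Classical in
/-- The greedy search for `z` as a scattered subword: the state `i` counts the letters of `z` found
so far, and it advances when the next letter of `z` is read. -/
noncomputable def greedyStep {α : Type*} (z : List α) (i : Fin (z.length + 1)) (a : α) :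
    Fin (z.length + 1) :=
  if h : ∃ h : (i : ℕ) < z.length, z[(i : ℕ)] = a then ⟨i + 1, Nat.succ_lt_succ h.1⟩ else i

theorem foldl_greedyStep_eq_last {α : Type*} (z w : List α) (i : Fin (z.length + 1)) :
    w.foldl (greedyStep z) i = Fin.last _ ↔ (z.drop i).Sublist w := by
  induction w generalizing i with
  | nil =>
    rw [List.foldl_nil, List.sublist_nil, List.drop_eq_nil_iff, Fin.ext_iff, Fin.val_last]
    exact ⟨fun h => h.ge, fun h => le_antisymm (Nat.lt_succ_iff.1 i.2) h⟩
  | cons a w ih =>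
    rw [List.foldl_cons, ih]
    by_cases hi : (i : ℕ) < z.length
    · rw [List.drop_eq_getElem_cons hi]
      by_cases ha : z[(i : ℕ)] = a
      · have : greedyStep z i a = ⟨i + 1, Nat.succ_lt_succ hi⟩ := dif_pos ⟨hi, ha⟩
        rw [this, ha, List.cons_sublist_cons]
      · have : greedyStep z i a = i := dif_neg fun h => ha h.2
        rw [this, List.drop_eq_getElem_cons hi, List.cons_sublist_cons']
        simp [ha]
    · have : greedyStep z i a = i := dif_neg fun h => hi h.1
      have h0 : z.drop i = [] := List.drop_eq_nil_iff.2 (by omega)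
      simp [this, h0]

theorem foldl_greedyStep_zero {α : Type*} (z w : List α) :
    w.foldl (greedyStep z) 0 = Fin.last _ ↔ z.Sublist w := by
  simpa using foldl_greedyStep_eq_last z w 0

/-! ### The minimal deterministic automaton -/

/-- The automaton that runs the greedy search for `z` and counts the length modulo `m`. -/
noncomputable def scatteredLengthDFA {α : Type*} (z : List α) (m : ℕ) :
    DFA α (Fin (z.length + 1) × ZMod m) where
  step s a := (greedyStep z s.1 a, s.2 + 1)
  start := (0, 0)
  accept := {(Fin.last _, 0)}

theorem scatteredLengthDFA_eval {α : Type*} (z w : List α) (m : ℕ) :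
    (scatteredLengthDFA z m).eval w = (w.foldl (greedyStep z) 0, (w.length : ZMod m)) := by
  induction w using List.reverseRecOn with
  | nil => simp [scatteredLengthDFA]
  | append_singleton w a ih =>
    rw [DFA.eval_append_singleton, ih]
    simp [scatteredLengthDFA]

theorem scatteredLengthDFA_accepts {α : Type*} {z : List α} {m : ℕ} (hz : 1 ≤ z.length) :
    (scatteredLengthDFA z m).accepts = scatteredLengthLanguage z m := by
  ext w
  rw [DFA.mem_accepts, scatteredLengthDFA_eval, mem_scatteredLengthLanguage hz,
    ← foldl_greedyStep_zero, ← ZMod.natCast_eq_zero_iff]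
  exact Prod.ext_iff

theorem cons_sublist_replicate_append {α : Type*} {a c : α} (h : c ≠ a) (l y : List α) (t : ℕ) :
    (a :: l).Sublist (List.replicate t c ++ y) ↔ (a :: l).Sublist y := by
  induction t with
  | zero => simp
  | succ t ih =>
    rw [List.replicate_succ, List.cons_append, List.cons_sublist_cons', ih]
    simp [h.symm]

theorem exists_forall_getElem_ne {α : Type*} [Nontrivial α] (z : List α) :
    ∃ c : ℕ → α, ∀ (i : ℕ) (hi : i < z.length), c i ≠ z[i] := by
  obtain ⟨a⟩ := (inferInstance : Nonempty α)
  choose f hf using fun x : α => exists_ne x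
  refine ⟨fun i => if h : i < z.length then f z[i] else a, fun i hi => ?_⟩
  simpa [hi] using hf z[i]

/-- After a prefix `z₁ ⋯ zᵢ` followed by copies of a letter that differs from `zᵢ₊₁`, exactly the
remaining letters of `z` have to be found. -/
theorem sublist_take_append_replicate_append {α : Type*} {z : List α} {c : ℕ → α}
    (hc : ∀ (i : ℕ) (hi : i < z.length), c i ≠ z[i]) (i t : ℕ) (y : List α) :
    z.Sublist (z.take i ++ List.replicate t (c i) ++ y) ↔ (z.drop i).Sublist y := by
  rw [List.append_assoc]
  nth_rw 1 [← List.take_append_drop i z]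
  rw [List.append_sublist_append_left]
  by_cases hi : i < z.length
  · rw [List.drop_eq_getElem_cons hi, cons_sublist_replicate_append (hc i hi)]
  · simp [List.drop_eq_nil_iff.2 (not_lt.1 hi)]

theorem exists_dvd_add (m a : ℕ) (hm : 0 < m) : ∃ t, m ∣ a + t :=
  ⟨a * (m - 1), by
    obtain ⟨k, rfl⟩ : ∃ k, m = k + 1 := ⟨m - 1, by omega⟩
    exact ⟨a, by simp; ring⟩⟩

/-- Words with different left quotients lead every automaton for the language to different states;
here there is one word for each number `i` of matched letters and each length modulo `m`. -/
theorem le_card_of_accepts_scatteredLengthLanguage {α : Type*} [Nontrivial α] {z : List α} {m : ℕ}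
    (hm : 0 < m) (hz : 1 ≤ z.length) {σ : Type*} [Fintype σ] (M : DFA α σ)
    (hM : M.accepts = scatteredLengthLanguage z m) : m * (z.length + 1) ≤ Fintype.card σ := by
  obtain ⟨c, hc⟩ := exists_forall_getElem_ne z
  have hmod : ∀ (i : Fin (z.length + 1)) (r : Fin m), ∃ t, m ∣ i + t + (m - r) := fun i r =>
    (exists_dvd_add m (i + (m - r)) hm).imp fun t ht => by
      rwa [show (i : ℕ) + t + (m - r) = i + (m - r) + t by omega]
  choose t ht using hmod
  obtain ⟨x, hlen, hmem⟩ : ∃ x : Fin m × Fin (z.length + 1) → List α,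
      (∀ p, m ∣ (x p).length + (m - p.1)) ∧
      ∀ p y, (x p ++ y) ∈ scatteredLengthLanguage z m ↔
        (z.drop p.2).Sublist y ∧ m ∣ (x p).length + y.length := by
    refine ⟨fun p => z.take p.2 ++ List.replicate (t p.2 p.1) (c p.2), fun p => ?_, fun p y => ?_⟩
    · have h : (p.2 : ℕ) ≤ z.length := Nat.lt_succ_iff.1 p.2.2
      simpa [Nat.min_eq_left h] using ht p.2 p.1
    · rw [mem_scatteredLengthLanguage hz, List.length_append,
        ← sublist_take_append_replicate_append hc p.2 (t p.2 p.1)]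
  have hquot : ∀ p q, M.eval (x p) = M.eval (x q) → ∀ y,
      (((z.drop p.2).Sublist y ∧ m ∣ (x p).length + y.length) ↔
        ((z.drop q.2).Sublist y ∧ m ∣ (x q).length + y.length)) := by
    intro p q h y
    rw [← hmem, ← hmem, ← hM, DFA.mem_accepts, DFA.mem_accepts]
    simp only [DFA.eval, DFA.evalFrom_of_append]
    exact iff_of_eq (congrArg (fun s => M.evalFrom s y ∈ M.accept) h)
  have hinj : Function.Injective fun p => M.eval (x p) := by
    intro p q h
    -- A suffix that starts with `z` tests only the total length, so it determines the length
    -- modulo `m`.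
    have hdvd : m ∣ (x q).length + (m - p.1) := by
      obtain ⟨s, hs⟩ := exists_dvd_add m (z.length + p.1) hm
      have hy := (hquot p q h (z ++ List.replicate s (c 0))).1
        ⟨(List.drop_sublist _ _).trans (List.sublist_append_left _ _), ?_⟩
      · have h2 := hy.2
        rw [List.length_append, List.length_replicate] at h2
        have : (x q).length + (m - p.1) + (z.length + p.1 + s) =
          (x q).length + (z.length + s) + m := by have := p.1.2; omega
        rw [← Nat.dvd_add_left hs, this]
        exact (Nat.dvd_add_self_right).2 h2
      · rw [List.length_append, List.length_replicate, ← Nat.dvd_add_self_right]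
        have : (x p).length + (z.length + s) + m =
          (x p).length + (m - p.1) + (z.length + p.1 + s) := by have := p.1.2; omega
        rw [this]
        exact (Nat.dvd_add_left hs).2 (hlen p)
    have h1 : p.1 = q.1 := by
      have h3 : (m - p.1) ≡ (m - q.1) [MOD m] := by
        refine Nat.ModEq.add_left_cancel' (x q).length ?_
        exact (Nat.modEq_zero_iff_dvd.2 hdvd).trans (Nat.modEq_zero_iff_dvd.2 (hlen q)).symm
      have h4 : (p.1 : ℕ) ≡ q.1 [MOD m] := by
        have hp := p.1.2
        have hq := q.1.2
        refine (Nat.ModEq.add_right_cancel h3 ?_)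
        rw [Nat.add_sub_cancel' hp.le, Nat.add_sub_cancel' hq.le]
      exact Fin.ext (Nat.ModEq.eq_of_lt_of_lt h4 p.1.2 q.1.2)
    -- If `i < j`, the suffix `c ⋯ c zⱼ₊₁ ⋯ zₙ` with `c ≠ zᵢ₊₁` separates `i` from `j`.
    have key : ∀ p q : Fin m × Fin (z.length + 1), M.eval (x p) = M.eval (x q) →
        ¬ (p.2 : ℕ) < q.2 := by
      intro p q h hlt
      have hi : (p.2 : ℕ) < z.length := by have := q.2.2; omega
      obtain ⟨s, hs⟩ := exists_dvd_add m ((x q).length + (z.drop q.2).length) hm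
      have hy := (hquot p q h (List.replicate s (c p.2) ++ z.drop q.2)).2
        ⟨List.sublist_append_right _ _, ?_⟩
      · have h2 := hy.1
        rw [List.drop_eq_getElem_cons hi, cons_sublist_replicate_append (hc _ hi)] at h2
        have := h2.length_le
        simp only [List.length_cons, List.length_drop] at this
        omega
      · rw [List.length_append, List.length_replicate]
        rwa [add_assoc, add_comm _ s] at hs
    exact Prod.ext h1 (Fin.ext (le_antisymm (not_lt.1 (key q p h.symm)) (not_lt.1 (key p q h))))
  simpa using Fintype.card_le_of_injective _ hinj

theorem isMinimalDFASize_scatteredLengthLanguage {α : Type*} [Nontrivial α] {z : List α} {m : ℕ}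
    (hm : 0 < m) (hz : 1 ≤ z.length) :
    IsMinimalDFASize (scatteredLengthLanguage z m) (m * (z.length + 1)) := by
  have : NeZero m := ⟨hm.ne'⟩
  refine ⟨⟨_, inferInstance, scatteredLengthDFA z m, ?_, scatteredLengthDFA_accepts hz⟩, ?_⟩
  · simp [ZMod.card, mul_comm]
  · rintro k ⟨σ, _, M, rfl, hM⟩
    exact le_card_of_accepts_scatteredLengthLanguage hm hz M hM

/-! ### Multi-letter automata -/

/-- The orbits of a linear isometry of a finite-dimensional space are recurrent. -/
theorem LinearIsometryEquiv.exists_iterate_dist_lt {E : Type*} [NormedAddCommGroup E]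
    [NormedSpace ℂ E] [ProperSpace E] (V : E ≃ₗᵢ[ℂ] E) (ψ : E) {ε : ℝ} (hε : 0 < ε) :
    ∃ j, 1 ≤ j ∧ dist (V^[j] ψ) ψ < ε := by
  have hV : ∀ j, ‖V^[j] ψ‖ = ‖ψ‖ := by
    intro j
    induction j with
    | zero => rfl
    | succ j ih => rw [Function.iterate_succ_apply', V.norm_map, ih]
  have hdist : ∀ j x y, dist (V^[j] x) (V^[j] y) = dist x y := by
    intro j
    induction j with
    | zero => intro x y; rfl
    | succ j ih =>
      intro x y
      rw [Function.iterate_succ_apply', Function.iterate_succ_apply', V.dist_map, ih]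
  obtain ⟨a, -, φ, hφ, ha⟩ := (isCompact_closedBall (0 : E) ‖ψ‖).tendsto_subseq
    (x := fun j => V^[j] ψ) (fun j => by simp [hV j])
  obtain ⟨N, hN⟩ := Metric.cauchySeq_iff.1 ha.cauchySeq ε hε
  have hlt : φ N < φ (N + 1) := hφ (Nat.lt_succ_self N)
  refine ⟨φ (N + 1) - φ N, by omega, ?_⟩
  have h := hN (N + 1) (Nat.le_succ N) N le_rfl
  simp only [Function.comp_apply] at h
  rw [← Nat.add_sub_of_le hlt.le, Function.iterate_add_apply] at h
  rwa [hdist] at h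

namespace MultiLetterQFA

variable {k : ℕ} {α Q : Type*} [Fintype Q]

/-- One step of a run: read a letter in a given window and quantum state. -/
noncomputable def next (A : MultiLetterQFA k α Q)
    (c : (Fin k → Option α) × EuclideanSpace ℂ Q) (a : α) :
    (Fin k → Option α) × EuclideanSpace ℂ Q :=
  (shift c.1 a, A.U (shift c.1 a) c.2)

theorem run_eq (A : MultiLetterQFA k α Q) (x : List α) :
    A.run x = x.foldl A.next (fun _ => none, A.init) :=
  rfl

/-- From a given window, reading a given word acts on the quantum state as a unitary operator. -/
theorem exists_foldl_next (A : MultiLetterQFA k α Q) (x : List α) (w : Fin k → Option α) :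
    ∃ (w' : Fin k → Option α) (V : EuclideanSpace ℂ Q ≃ₗᵢ[ℂ] EuclideanSpace ℂ Q),
      ∀ ψ, x.foldl A.next (w, ψ) = (w', V ψ) := by
  induction x generalizing w with
  | nil => exact ⟨w, LinearIsometryEquiv.refl ℂ _, fun ψ => rfl⟩
  | cons a x ih =>
    obtain ⟨w', V, h⟩ := ih (shift w a)
    exact ⟨w', (A.U (shift w a)).trans V, fun ψ => h _⟩

theorem foldl_next_replicate_fst (A : MultiLetterQFA k α Q) (b : α)
    (c : (Fin k → Option α) × EuclideanSpace ℂ Q) {t : ℕ} (ht : k ≤ t) :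
    ((List.replicate t b).foldl A.next c).1 = fun _ => some b := by
  suffices h : ∀ (t : ℕ) (j : Fin k), k ≤ j + t →
      ((List.replicate t b).foldl A.next c).1 j = some b from
    funext fun j => h t j (by omega)
  intro t
  induction t with
  | zero => intro j hj; omega
  | succ t ih =>
    intro j hj
    rw [List.replicate_succ', List.foldl_append]
    simp only [List.foldl_cons, List.foldl_nil, next, shift]
    split_ifs with h
    · exact ih _ (by simp only; omega)
    · rfl

/-- If a word ends in `k` copies of `b`, then pumping it after `k` copies of `b` applies the same
unitary operator each time, so by recurrence it comes back close to the state before the word. -/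
theorem exists_acceptProb_sub_lt (A : MultiLetterQFA k α Q) (b : α) {t : ℕ} (ht : k ≤ t)
    (v : List α) {η : ℝ} (hη : 0 < η) :
    ∃ j, 1 ≤ j ∧
      |A.acceptProb (List.replicate t b ++
          (List.replicate j (v ++ List.replicate t b)).flatten) -
        A.acceptProb (List.replicate t b)| < η := by
  obtain ⟨ψ, hψ⟩ : ∃ ψ, A.run (List.replicate t b) = (fun _ => some b, ψ) :=
    ⟨_, Prod.ext (A.foldl_next_replicate_fst b _ ht) rfl⟩
  obtain ⟨w', V, hV⟩ := A.exists_foldl_next (v ++ List.replicate t b) (fun _ => some b)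
  obtain rfl : w' = fun _ => some b := by
    rw [← A.foldl_next_replicate_fst b (v.foldl A.next (fun _ => some b, ψ)) ht,
      ← List.foldl_append, hV]
  have hpump : ∀ j ψ, (List.replicate j (v ++ List.replicate t b)).flatten.foldl A.next
      (fun _ => some b, ψ) = (fun _ => some b, V^[j] ψ) := by
    intro j
    induction j with
    | zero => intro ψ; rfl
    | succ j ih =>
      intro ψ
      rw [List.replicate_succ, List.flatten_cons, List.foldl_append, hV, ih,
        Function.iterate_succ_apply]
  have hcont : Continuous fun ψ : EuclideanSpace ℂ Q => ∑ q ∈ A.acc, ‖ψ q‖ ^ 2 := by fun_prop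
  obtain ⟨ε, hε, h⟩ := Metric.continuous_iff.1 hcont ψ η hη
  obtain ⟨j, hj, hd⟩ := V.exists_iterate_dist_lt ψ hε
  refine ⟨j, hj, ?_⟩
  have hrun : A.run (List.replicate t b ++
      (List.replicate j (v ++ List.replicate t b)).flatten) = (fun _ => some b, V^[j] ψ) := by
    rw [run_eq, List.foldl_append, ← run_eq, hψ, hpump]
  rw [acceptProb, acceptProb, hrun, hψ, ← Real.dist_eq]
  exact h _ hd

end MultiLetterQFA

theorem not_acceptedByMultiLetterQFA_scatteredLengthLanguage {α : Type*} [Nontrivial α]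
    {z : List α} {m : ℕ} (hm : 0 < m) (hz : 1 ≤ z.length) :
    ¬ AcceptedByMultiLetterQFA (scatteredLengthLanguage z m) := by
  rintro ⟨k, Q, _, A, -, c, δ, -, -, hδ, hacc, hrej⟩
  obtain ⟨b, hb⟩ := exists_ne z[0]
  obtain ⟨m', rfl⟩ : ∃ m', m = m' + 1 := ⟨m - 1, by omega⟩
  have hkm : k ≤ (m' + 1) * k := Nat.le_mul_of_pos_left k hm
  -- The factor `z ^ m` contains `z` and has a length divisible by `m`.
  obtain ⟨j, hj, h⟩ := A.exists_acceptProb_sub_lt b hkm (List.replicate (m' + 1) z).flatten hδ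
  have hin := hacc (List.replicate ((m' + 1) * k) b ++
      (List.replicate j ((List.replicate (m' + 1) z).flatten ++
        List.replicate ((m' + 1) * k) b)).flatten) <| by
    rw [mem_scatteredLengthLanguage hz]
    constructor
    · obtain ⟨j, rfl⟩ : ∃ i, j = i + 1 := ⟨j - 1, by omega⟩
      rw [List.replicate_succ, List.flatten_cons, List.replicate_succ, List.flatten_cons]
      simp only [List.append_assoc]
      exact (List.sublist_append_left _ _).trans (List.sublist_append_right _ _)
    · simp only [List.length_append, List.length_replicate, List.length_flatten,
        List.map_replicate, List.sum_replicate, smul_eq_mul]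
      exact dvd_add (dvd_mul_right _ _)
        (Dvd.dvd.mul_left (dvd_add (dvd_mul_right _ _) (dvd_mul_right _ _)) _)
  have hout := hrej (List.replicate ((m' + 1) * k) b) <| by
    rw [mem_scatteredLengthLanguage hz]
    rintro ⟨hs, -⟩
    exact hb (List.eq_of_mem_replicate (hs.subset (List.getElem_mem _))).symm
  linarith [(abs_lt.1 h).2]

/-! ### Small character sums over few elements -/

/-- The exponential moment bound behind Hoeffding's inequality. -/
theorem sum_exp_mul_le {G : Type*} [Fintype G] (g : G → ℝ) (hg : ∀ x, |g x| ≤ 1)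
    (h0 : ∑ x, g x = 0) {t : ℝ} (ht : |t| ≤ 1) :
    ∑ x, Real.exp (t * g x) ≤ Fintype.card G * Real.exp (t ^ 2) := by
  have h1 : ∀ x, Real.exp (t * g x) ≤ 1 + t * g x + t ^ 2 := by
    intro x
    have hx : |t * g x| ≤ |t| := by
      rw [abs_mul]
      exact mul_le_of_le_one_right (abs_nonneg t) (hg x)
    have h2 := (abs_le.1 (Real.abs_exp_sub_one_sub_id_le (hx.trans ht))).2
    have h3 : (t * g x) ^ 2 ≤ t ^ 2 := sq_le_sq.2 hx
    linarith
  calc ∑ x, Real.exp (t * g x) ≤ ∑ x, (1 + t * g x + t ^ 2) := Finset.sum_le_sum fun x _ => h1 x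
    _ = Fintype.card G * (t ^ 2 + 1) := by
      simp only [Finset.sum_add_distrib, ← Finset.mul_sum, h0, Finset.sum_const, Finset.card_univ,
        nsmul_eq_mul]
      ring
    _ ≤ _ := by gcongr; exact Real.add_one_le_exp _

/-- Finitely many centred functions bounded by `1` have small sums over one common sample of `d`
points, as soon as `d` is logarithmic in the number of functions: otherwise the union bound for the
exponential moments over all samples would fail. -/
theorem exists_forall_abs_sum_lt {G ι : Type*} [Fintype G] [Nonempty G] [Fintype ι]
    (g : ι → G → ℝ) (hg : ∀ l x, |g l x| ≤ 1) (h0 : ∀ l, ∑ x, g l x = 0) {δ : ℝ} (hδ0 : 0 ≤ δ)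
    (hδ : δ ≤ 1) (d : ℕ) (hd : 2 * (Fintype.card ι : ℝ) < Real.exp (d * δ ^ 2 / 4)) :
    ∃ κ : Fin d → G, ∀ l, |∑ i, g l (κ i)| < δ * d := by
  by_contra! hcon
  -- `δ / 2` minimizes the exponent `t ^ 2 * d - t * δ * d` of the Chernoff bound.
  set t : ℝ := δ / 2 with ht
  have hmoment : ∀ (s : ℝ), |s| ≤ 1 → ∀ l, ∑ κ : Fin d → G, Real.exp (s * ∑ i, g l (κ i)) ≤
      (Fintype.card G : ℝ) ^ d * Real.exp (d * s ^ 2) := by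
    intro s hs l
    calc ∑ κ : Fin d → G, Real.exp (s * ∑ i, g l (κ i))
        = (∑ x, Real.exp (s * g l x)) ^ d := by
          rw [Fintype.sum_pow]
          simp only [Finset.mul_sum, Real.exp_sum]
      _ ≤ (Fintype.card G * Real.exp (s ^ 2)) ^ d :=
          pow_le_pow_left₀ (Finset.sum_nonneg fun x _ => (Real.exp_pos _).le)
            (sum_exp_mul_le (g l) (hg l) (h0 l) hs) d
      _ = _ := by rw [mul_pow, ← Real.exp_nat_mul]
  have ht1 : |t| ≤ 1 := abs_le.2 ⟨by linarith, by linarith⟩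
  have hlower : ∀ κ : Fin d → G, Real.exp (t * (δ * d)) ≤
      ∑ l, (Real.exp (t * ∑ i, g l (κ i)) + Real.exp (-t * ∑ i, g l (κ i))) := by
    intro κ
    obtain ⟨l, hl⟩ := hcon κ
    refine le_trans ?_ (Finset.single_le_sum
      (f := fun l => Real.exp (t * ∑ i, g l (κ i)) + Real.exp (-t * ∑ i, g l (κ i)))
      (fun l _ => by positivity) (Finset.mem_univ l))
    have ht0 : 0 ≤ t := by linarith
    rcases le_abs.1 hl with h | h
    · exact le_add_of_le_of_nonneg (Real.exp_le_exp.2 (mul_le_mul_of_nonneg_left h ht0))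
        (Real.exp_pos _).le
    · refine le_add_of_nonneg_of_le (Real.exp_pos _).le (Real.exp_le_exp.2 ?_)
      rw [neg_mul, ← mul_neg]
      exact mul_le_mul_of_nonneg_left h ht0
  have hsum := Finset.sum_le_sum fun κ (_ : κ ∈ (Finset.univ : Finset (Fin d → G))) => hlower κ
  rw [Finset.sum_comm] at hsum
  simp only [Finset.sum_add_distrib, Finset.sum_const, Finset.card_univ, nsmul_eq_mul,
    Fintype.card_fun, Fintype.card_fin, Nat.cast_pow] at hsum
  have hupper : ∀ s : ℝ, |s| ≤ 1 → ∑ l, ∑ κ : Fin d → G, Real.exp (s * ∑ i, g l (κ i)) ≤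
      Fintype.card ι * ((Fintype.card G : ℝ) ^ d * Real.exp (d * s ^ 2)) := fun s hs =>
    (Finset.sum_le_sum fun l _ => hmoment s hs l).trans_eq (by simp)
  have h1 := hupper t ht1
  have h2 := hupper (-t) (by rwa [abs_neg])
  rw [neg_sq] at h2
  have hG : (0 : ℝ) < (Fintype.card G : ℝ) ^ d := by
    have := Fintype.card_pos (α := G)
    positivity
  have h3 : (Fintype.card G : ℝ) ^ d * Real.exp (t * (δ * d)) ≤
      (Fintype.card G : ℝ) ^ d * (2 * Fintype.card ι * Real.exp (d * t ^ 2)) := by linarith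
  have h4 := le_of_mul_le_mul_left h3 hG
  have h5 : t * (δ * d) = d * δ ^ 2 / 4 + d * t ^ 2 := by rw [ht]; ring
  rw [h5, Real.exp_add] at h4
  exact absurd (le_of_mul_le_mul_right h4 (Real.exp_pos _)) (not_le.2 hd)

open ZMod in
theorem exists_forall_norm_sum_stdAddChar_sq_lt {m : ℕ} [NeZero m] {δ : ℝ} (hδ0 : 0 ≤ δ)
    (hδ : δ ≤ 1) (d : ℕ) (hd : 4 * (m : ℝ) < Real.exp (d * δ ^ 2 / 4)) :
    ∃ κ : Fin d → ZMod m, ∀ l : ZMod m, l ≠ 0 →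
      ‖∑ i, stdAddChar (κ i * l)‖ ^ 2 < 2 * (δ * d) ^ 2 := by
  have hnorm : ∀ x : ZMod m, ‖stdAddChar x‖ = 1 := fun x => by
    rw [stdAddChar_apply, Circle.norm_coe]
  have hsum : ∀ l : {l : ZMod m // l ≠ 0}, ∑ x : ZMod m, stdAddChar (x * (l : ZMod m)) = 0 := by
    intro l
    simpa [l.2] using AddChar.sum_mulShift (l : ZMod m) (isPrimitive_stdAddChar m)
  -- The real and the imaginary parts of the nontrivial characters, all in one family.
  obtain ⟨κ, hκ⟩ := exists_forall_abs_sum_lt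
    (ι := {l : ZMod m // l ≠ 0} × Bool) (G := ZMod m)
    (fun l x => if l.2 then (stdAddChar (x * (l.1 : ZMod m)) : ℂ).re
      else (stdAddChar (x * (l.1 : ZMod m)) : ℂ).im)
    (by
      rintro ⟨l, _ | _⟩ x
      · simpa [hnorm] using Complex.abs_im_le_norm (stdAddChar (x * (l : ZMod m)))
      · simpa [hnorm] using Complex.abs_re_le_norm (stdAddChar (x * (l : ZMod m))))
    (by
      rintro ⟨l, _ | _⟩
      · simpa using congrArg Complex.im (hsum l)
      · simpa using congrArg Complex.re (hsum l)) hδ0 hδ d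
    (by
      refine lt_of_le_of_lt ?_ hd
      have h := Fintype.card_subtype_le fun l : ZMod m => l ≠ 0
      rw [ZMod.card] at h
      rw [Fintype.card_prod, Fintype.card_bool]
      have h' : ((Fintype.card {l : ZMod m // l ≠ 0} : ℕ) : ℝ) ≤ m := by exact_mod_cast h
      push_cast
      linarith)
  refine ⟨κ, fun l hl => ?_⟩
  have hre := hκ (⟨l, hl⟩, true)
  have him := hκ (⟨l, hl⟩, false)
  simp only [if_true, Bool.false_eq_true, if_false, ← Complex.re_sum, ← Complex.im_sum]
    at hre him
  rw [← Complex.normSq_eq_norm_sq, Complex.normSq_apply]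
  have h1 := sq_lt_sq' (abs_lt.1 hre).1 (abs_lt.1 hre).2
  have h2 := sq_lt_sq' (abs_lt.1 him).1 (abs_lt.1 him).2
  nlinarith

/-! ### An automaton with logarithmically many quantum basis states -/

/-- The diagonal unitary operator that multiplies the `i`-th coordinate by `χ (κ i)`, where `χ` is
the standard additive character of `ZMod m`. -/
noncomputable def phaseOperator {m d : ℕ} [NeZero m] (κ : Fin d → ZMod m) :
    EuclideanSpace ℂ (Fin d) ≃ₗᵢ[ℂ] EuclideanSpace ℂ (Fin d) :=
  LinearIsometryEquiv.piLpCongrRight 2 fun i =>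
    { LinearEquiv.smulOfNeZero ℂ ℂ (ZMod.toCircle (κ i) : ℂ) (Circle.coe_ne_zero _) with
      norm_map' := fun x => by
        change ‖(ZMod.toCircle (κ i) : ℂ) • x‖ = ‖x‖
        rw [norm_smul, Circle.norm_coe, one_mul] }

theorem phaseOperator_apply {m d : ℕ} [NeZero m] (κ : Fin d → ZMod m)
    (ψ : EuclideanSpace ℂ (Fin d)) (i : Fin d) :
    phaseOperator κ ψ i = ZMod.stdAddChar (κ i) * ψ i :=
  rfl

/-- The uniform superposition of `d` basis states. -/
noncomputable def uniformState (d : ℕ) : EuclideanSpace ℂ (Fin d) :=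
  WithLp.toLp 2 fun _ => (((√d)⁻¹ : ℝ) : ℂ)

theorem norm_uniformState (d : ℕ) [NeZero d] : ‖uniformState d‖ = 1 := by
  have hd : (d : ℝ) ≠ 0 := NeZero.ne _
  rw [EuclideanSpace.norm_eq, Real.sqrt_eq_one]
  simp [uniformState, inv_pow, hd]

/-- The automaton that runs the greedy search for `z` in its classical states, and counts the length
modulo `m` in the phases of its quantum state. Once `z` is found, it measures whether the quantum
state is still the initial one; before that, it rejects. -/
noncomputable def phaseQFAC {α : Type*} {m d : ℕ} [NeZero m] [NeZero d] (z : List α)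
    (κ : Fin d → ZMod m) : OneQFAC α Bool (Fin (z.length + 1)) (Fin d) :=
  let K : Fin (z.length + 1) → Submodule ℂ (EuclideanSpace ℂ (Fin d)) := fun s =>
    if s = Fin.last _ then ℂ ∙ uniformState d else ⊥
  { start := 0
    init := uniformState d
    norm_init := norm_uniformState d
    step := greedyStep z
    U := fun _ _ => phaseOperator κ
    P := fun s b => if b then (K s).starProjection else 1 - (K s).starProjection
    isStarProjection_P := by
      rintro s (_ | _)
      · exact isStarProjection_starProjection.one_sub
      · exact isStarProjection_starProjection
    orthogonal_P := by
      rintro s (_ | _) (_ | _) h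
      · exact absurd rfl h
      · exact (isStarProjection_starProjection (U := K s)).one_sub_mul_self
      · exact (isStarProjection_starProjection (U := K s)).mul_one_sub_self
      · exact absurd rfl h
    sum_P := fun s => by simp }

theorem phaseQFAC_run {α : Type*} {m d : ℕ} [NeZero m] [NeZero d] (z : List α)
    (κ : Fin d → ZMod m) (w : List α) :
    (phaseQFAC z κ).run w = (w.foldl (greedyStep z) 0,
      WithLp.toLp 2 fun i => ZMod.stdAddChar (κ i * (w.length : ZMod m)) * (((√d)⁻¹ : ℝ) : ℂ)) := by
  induction w using List.reverseRecOn with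
  | nil => simp [OneQFAC.run, phaseQFAC, uniformState]
  | append_singleton w a ih =>
    rw [OneQFAC.run] at ih ⊢
    rw [List.foldl_append, ih, List.foldl_append]
    simp only [List.foldl_cons, List.foldl_nil, phaseQFAC]
    refine Prod.ext rfl (PiLp.ext fun i => ?_)
    simp only
    rw [phaseOperator_apply]
    simp [mul_add, AddChar.map_add_eq_mul]
    ring

open Classical in
theorem phaseQFAC_acceptProb {α : Type*} {m d : ℕ} [NeZero m] [NeZero d] (z : List α)
    (κ : Fin d → ZMod m) (w : List α) :
    (phaseQFAC z κ).acceptProb w = if z.Sublist w then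
      ‖∑ i, ZMod.stdAddChar (κ i * (w.length : ZMod m))‖ ^ 2 / (d : ℝ) ^ 2 else 0 := by
  rw [OneQFAC.acceptProb, OneQFAC.prob, phaseQFAC_run]
  split_ifs with h
  · simp only [phaseQFAC, (foldl_greedyStep_zero z w).2 h, if_true]
    rw [Submodule.starProjection_unit_singleton ℂ (norm_uniformState d), norm_smul,
      norm_uniformState, mul_one, PiLp.inner_apply]
    have hd : ((√d : ℝ) : ℂ) * (√d : ℝ) = d := by
      rw [← Complex.ofReal_mul, Real.mul_self_sqrt (Nat.cast_nonneg d), Complex.ofReal_natCast]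
    have : ∀ i : Fin d, inner ℂ (uniformState d i)
        (ZMod.stdAddChar (κ i * (w.length : ZMod m)) * (((√d)⁻¹ : ℝ) : ℂ)) =
        ZMod.stdAddChar (κ i * (w.length : ZMod m)) / d := by
      intro i
      rw [← hd]
      simp [uniformState, div_eq_mul_inv, mul_assoc]
    simp only [this, ← Finset.sum_div, norm_div, div_pow, Complex.norm_natCast]
  · have h' : w.foldl (greedyStep z) 0 ≠ Fin.last _ := fun h' =>
      h ((foldl_greedyStep_zero z w).1 h')
    simp [phaseQFAC, h']

theorem phaseQFAC_acceptsOneSided {α : Type*} {m d : ℕ} [NeZero m] [NeZero d] {z : List α}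
    (hz : 1 ≤ z.length) {κ : Fin d → ZMod m} {ε δ : ℝ} (hε : 0 < ε) (hδ : 2 * δ ^ 2 ≤ ε)
    (hκ : ∀ l : ZMod m, l ≠ 0 → ‖∑ i, ZMod.stdAddChar (κ i * l)‖ ^ 2 < 2 * (δ * d) ^ 2) :
    (phaseQFAC z κ).AcceptsOneSided (scatteredLengthLanguage z m) ε := by
  classical
  have hd : (d : ℝ) ≠ 0 := NeZero.ne _
  refine ⟨fun w hw => ?_, fun w hw => ?_⟩
  · rw [mem_scatteredLengthLanguage hz, ← ZMod.natCast_eq_zero_iff] at hw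
    rw [phaseQFAC_acceptProb, if_pos hw.1, hw.2]
    simp [hd]
  · rw [mem_scatteredLengthLanguage hz, ← ZMod.natCast_eq_zero_iff, not_and] at hw
    rw [phaseQFAC_acceptProb]
    split_ifs with h
    · rw [div_lt_iff₀ (by positivity)]
      calc _ < 2 * (δ * d) ^ 2 := hκ _ (hw h)
        _ = 2 * δ ^ 2 * (d : ℝ) ^ 2 := by ring
        _ ≤ _ := by gcongr
    · exact hε

/-- The dimension `d = ⌊4 log (4 m) / δ²⌋ + 1` that the sampling bound allows is at most
`(12 / δ² + 2) log m`, because `m ≥ 2`. -/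
theorem exists_oneQFAC_acceptsOneSided {α : Type*} {m : ℕ} (hm : 2 ≤ m) {z : List α}
    (hz : 1 ≤ z.length) {ε δ : ℝ} (hδ0 : 0 < δ) (hδ1 : δ ≤ 1) (hδ : 2 * δ ^ 2 ≤ ε) :
    ∃ (S Q : Type) (_ : Fintype S) (_ : Fintype Q) (A : OneQFAC α Bool S Q),
      Fintype.card S = z.length + 1 ∧
      (Fintype.card Q : ℝ) ≤ (12 / δ ^ 2 + 2) * Real.log m ∧
      A.AcceptsOneSided (scatteredLengthLanguage z m) ε := by
  have : NeZero m := ⟨by omega⟩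
  have hm0 : (0 : ℝ) < m := by positivity
  have hm2 : (2 : ℝ) ≤ m := by exact_mod_cast hm
  have hlog : Real.log 2 ≤ Real.log m := Real.log_le_log two_pos hm2
  have hlog2 := Real.log_two_gt_d9
  have hlog4 : Real.log (4 * m) ≤ 3 * Real.log m := by
    have h4 : Real.log 4 = 2 * Real.log 2 := by
      rw [show (4 : ℝ) = 2 ^ 2 by norm_num, Real.log_pow]
      norm_num
    rw [Real.log_mul four_ne_zero hm0.ne', h4]
    linarith
  have hδ2 : 0 < δ ^ 2 := by positivity
  set d : ℕ := ⌊4 * Real.log (4 * m) / δ ^ 2⌋₊ + 1 with hd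
  have hd1 : 4 * Real.log (4 * m) / δ ^ 2 < d := by
    rw [hd]
    exact_mod_cast Nat.lt_floor_add_one _
  have hd2 : (d : ℝ) ≤ (12 / δ ^ 2 + 2) * Real.log m := by
    have hnonneg : 0 ≤ Real.log (4 * m) := Real.log_nonneg (by linarith)
    calc (d : ℝ) ≤ 4 * Real.log (4 * m) / δ ^ 2 + 1 := by
          rw [hd]
          push_cast
          gcongr
          exact Nat.floor_le (by positivity)
      _ ≤ 4 * (3 * Real.log m) / δ ^ 2 + 2 * Real.log m := by
          gcongr
          linarith
      _ = _ := by ring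
  obtain ⟨κ, hκ⟩ := exists_forall_norm_sum_stdAddChar_sq_lt (m := m) hδ0.le hδ1 d <| by
    rw [← Real.log_lt_iff_lt_exp (by positivity)]
    rw [div_lt_iff₀ hδ2] at hd1
    linarith
  exact ⟨Fin (z.length + 1), Fin d, inferInstance, inferInstance, phaseQFAC z κ,
    Fintype.card_fin _, by simpa using hd2,
    phaseQFAC_acceptsOneSided hz (lt_of_lt_of_le (by positivity) hδ) hδ hκ⟩

theorem mainTheorem3 :
    ∃ C : ℝ → ℝ, ∀ (α : Type u) [Fintype α] (m : ℕ) (z : List α), m.Prime → 1 ≤ z.length →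
      (scatteredLengthLanguage z m).IsRegular ∧
      (Nontrivial α → ¬ AcceptedByMultiLetterQFA (scatteredLengthLanguage z m)) ∧
      (∀ ε : ℝ, 0 < ε →
        ∃ (S Q : Type) (_ : Fintype S) (_ : Fintype Q) (A : OneQFAC α Bool S Q),
          Fintype.card S = z.length + 1 ∧
          (Fintype.card Q : ℝ) ≤ C ε * Real.log m ∧
          A.AcceptsOneSided (scatteredLengthLanguage z m) ε) ∧
      (Nontrivial α → IsMinimalDFASize (scatteredLengthLanguage z m) (m * (z.length + 1))) := by
  refine ⟨fun ε => 12 / min 1 (ε / 2) ^ 2 + 2, fun α _ m z hm hz =>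
    ⟨?_, fun _ => ?_, ?_, fun _ => ?_⟩⟩
  · have : NeZero m := ⟨hm.ne_zero⟩
    exact ⟨_, inferInstance, scatteredLengthDFA z m, scatteredLengthDFA_accepts hz⟩
  · exact not_acceptedByMultiLetterQFA_scatteredLengthLanguage hm.pos hz
  · intro ε hε
    have hδ0 : 0 < min 1 (ε / 2) := lt_min one_pos (by positivity)
    refine exists_oneQFAC_acceptsOneSided hm.two_le hz hδ0 (min_le_left _ _) ?_
    have h := mul_le_mul (min_le_left 1 (ε / 2)) (min_le_right 1 (ε / 2)) hδ0.le one_pos.le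
    rw [sq]
    linarith
  · exact isMinimalDFASize_scatteredLengthLanguage hm.pos hz
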